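/- There is an absolute constant $C>0$ with the following property. Let $n\ge 1$, let $V:\mathbb R^n\to\mathbb R$ be bounded and continuous with $V(x)>0$ for every $x\in\mathbb R^n$, and let $u_0\in L^2(\mathbb R^n)$ be real-valued with $$K_{0,h}^2:=\int_{\mathbb R^n}\frac{|u_0(x)|^2}{V(x)}\,dx<\infty .$$ Then the Cauchy problem $$u_t-\Delta u+V(x)u=0\quad (t>0,\ x\in\mathbb R^n),\qquad u(0,\cdot)=u_0,$$ where the equation is understood as an equality in $L^2(\mathbb R^n)$ for each $t>0$, has a unique real-valued solution $u\in C([0,\infty);L^2(\mathbb R^n))\cap C^1((0,\infty);L^2(\mathbb R^n))\cap C((0,\infty);H^2(\mathbb R^n))$, and this solution satisfies $$(1+t)\,\|u(t,\cdot)\|_{L^2(\mathbb R^n)}^2\le C\left(\|u_0\|_{L^2(\mathbb R^n)}^2+K_{0,h}^2\right)\qquad\text{for all } t\ge 0 .$$ -/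

import Mathlib

open MeasureTheory Set
open scoped ContDiff BoundedContinuousFunction

noncomputable section

/-- The real Hilbert space `L²(ℝⁿ)` of (classes of) real-valued functions. -/
abbrev L2 (n : ℕ) : Type := Lp ℝ 2 (volume : Measure (EuclideanSpace ℝ (Fin n)))

/-- `g` is the weak partial derivative `∂f/∂xᵢ`: `∫ f ∂ᵢφ = - ∫ g φ` for all `φ ∈ C_c^∞(ℝⁿ)`. -/
def HasWeakPartial {n : ℕ} (i : Fin n) (f g : L2 n) : Prop :=
  ∀ φ : EuclideanSpace ℝ (Fin n) → ℝ, ContDiff ℝ ∞ φ → HasCompactSupport φ →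
    ∫ x, f x * fderiv ℝ φ x (EuclideanSpace.single i 1) = -∫ x, g x * φ x

/-- Weak partial derivatives in `L²(ℝⁿ)` are unique. -/
theorem HasWeakPartial.unique {n : ℕ} {i : Fin n} {f g h : L2 n}
    (hg : HasWeakPartial i f g) (hh : HasWeakPartial i f h) : g = h := by
  have hloc (k : L2 n) : LocallyIntegrable (k : EuclideanSpace ℝ (Fin n) → ℝ) volume :=
    (Lp.memLp k).locallyIntegrable (by norm_num)
  apply Lp.ext
  apply ae_eq_of_integral_contDiff_smul_eq (hloc g) (hloc h)
  intro φ hφ hc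
  have h1 := hg φ hφ hc
  rw [hh φ hφ hc, neg_inj] at h1
  simpa only [smul_eq_mul, mul_comm] using h1.symm

open Classical in
/-- The weak partial derivative `∂f/∂xᵢ ∈ L²(ℝⁿ)` of `f` (and `0` if there is none in `L²`). -/
def weakPartial {n : ℕ} (i : Fin n) (f : L2 n) : L2 n :=
  if h : ∃ g, HasWeakPartial i f g then h.choose else 0

theorem HasWeakPartial.weakPartial_eq {n : ℕ} {i : Fin n} {f g : L2 n}
    (hg : HasWeakPartial i f g) : weakPartial i f = g := by
  have h : ∃ g, HasWeakPartial i f g := ⟨g, hg⟩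
  rw [weakPartial, dif_pos h]
  exact h.choose_spec.unique hg

/-- Membership in the Sobolev space `H²(ℝⁿ)`: all weak partial derivatives of `f` of
orders one and two exist in `L²(ℝⁿ)`. -/
def MemH2 {n : ℕ} (f : L2 n) : Prop :=
  ∀ i : Fin n, HasWeakPartial i f (weakPartial i f) ∧
    ∀ j : Fin n, HasWeakPartial j (weakPartial i f) (weakPartial j (weakPartial i f))

/-- `u ∈ C(s; H²(ℝⁿ))`: `u` takes values in `H²(ℝⁿ)` on `s`, and it is continuous on `s` for the
norm `(‖f‖² + ∑ᵢ ‖∂ᵢf‖² + ∑ᵢⱼ ‖∂ⱼ∂ᵢf‖²)^{1/2}`, that is, `u`, `∂ᵢu` and `∂ⱼ∂ᵢu` are continuous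
on `s` with values in `L²(ℝⁿ)`. -/
def ContinuousOnH2 {n : ℕ} (u : ℝ → L2 n) (s : Set ℝ) : Prop :=
  (∀ t ∈ s, MemH2 (u t)) ∧ ContinuousOn u s ∧
    (∀ i : Fin n, ContinuousOn (fun t => weakPartial i (u t)) s) ∧
    ∀ i j : Fin n, ContinuousOn (fun t => weakPartial j (weakPartial i (u t))) s

/-- The Laplacian `Δf = ∑ᵢ ∂ᵢ∂ᵢf` of `f ∈ H²(ℝⁿ)`. -/
def weakLaplacian {n : ℕ} (f : L2 n) : L2 n :=
  ∑ i : Fin n, weakPartial i (weakPartial i f)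

/-- `u ∈ C([0,∞); L²) ∩ C¹((0,∞); L²) ∩ C((0,∞); H²)` solves `u_t - Δu + V u = 0` for `t > 0`
with `u(0) = u₀`. Only the values of `u` on `[0,∞)` matter. -/
structure IsHeatSolution {n : ℕ} (V : EuclideanSpace ℝ (Fin n) →ᵇ ℝ) (u₀ : L2 n)
    (u : ℝ → L2 n) : Prop where
  continuousOn_L2 : ContinuousOn u (Ici 0)
  contDiffOn_L2 : ContDiffOn ℝ 1 u (Ioi 0)
  continuousOn_H2 : ContinuousOnH2 u (Ioi 0)
  equation : ∀ t : ℝ, 0 < t →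
    ∀ᵐ x : EuclideanSpace ℝ (Fin n), deriv u t x - weakLaplacian (u t) x + V x * u t x = 0
  initial : u 0 = u₀

end

/-
Let `A = -Δ + V`, a nonnegative self-adjoint operator. All that is needed of it is its resolvent
`J = (1 + A)⁻¹`, the solution of `J = J₀ (1 - V J)` where the free resolvent `J₀ = (1 - Δ)⁻¹` is a
Fourier multiplier; for `t > 0`, `e^{-tA}` is a continuous function of the bounded operator `J`.
Then `u(t) = e^{-tA} u₀` is a solution, in `H²` because it is in the range of `J₀`, and it is the
only one because the norm of a difference of two solutions is nonincreasing. For the decay, write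
`u₀ = √V f` with `‖f‖² = ∫ u₀² / V`. As `V ≤ A` in the sense of quadratic forms,
`‖e^{-tA} √V‖² = ‖e^{-tA} V e^{-tA}‖ ≤ ‖A e^{-2tA}‖ ≤ 1 / t`, so that `t ‖u(t)‖² ≤ ‖f‖²`.
-/

noncomputable section

open Filter TemperedDistribution
open scoped SchwartzMap FourierTransform LineDeriv InnerProductSpace Topology ENNReal ComplexOrder

section FunctionalCalculus

variable {A : Type*} [NormedRing A] [StarRing A] [NormedAlgebra ℝ A] {p : A → Prop}
  [IsometricContinuousFunctionalCalculus ℝ A p]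

theorem continuousOn_uncurry_apply {X Y Z : Type*} [TopologicalSpace X] [TopologicalSpace Y]
    [TopologicalSpace Z] {f : X → Y → Z} {s : Set X} {k : Set Y}
    (hf : ContinuousOn f.uncurry (s ×ˢ k)) {x : X} (hx : x ∈ s) : ContinuousOn (f x) k :=
  hf.comp (Continuous.prodMk_right x).continuousOn fun _ hy => ⟨hx, hy⟩

theorem continuousOn_cfc_of_continuousOn_uncurry {X : Type*} [TopologicalSpace X]
    {f : X → ℝ → ℝ} {s : Set X} (a : A) (hf : ContinuousOn f.uncurry (s ×ˢ spectrum ℝ a)) :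
    ContinuousOn (fun x => cfc (f x) a) s := by
  intro x hx
  refine continuousWithinAt_cfc_fun (fun u hu => ?_)
    (eventually_mem_nhdsWithin.mono fun y hy => continuousOn_uncurry_apply hf hy)
  obtain ⟨v, hv, hvu⟩ := (ContinuousFunctionalCalculus.isCompact_spectrum a).mem_uniformity_of_prod
    hf hx (symm_le_uniformity hu)
  exact mem_of_superset hv hvu

theorem hasDerivAt_cfc {F F' : ℝ → ℝ → ℝ} {s : Set ℝ} (hs : IsOpen s) {a : A}
    (hF : ∀ t ∈ s, ∀ x ∈ spectrum ℝ a, HasDerivAt (F · x) (F' t x) t)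
    (hFc : ∀ t ∈ s, ContinuousOn (F t) (spectrum ℝ a))
    (hF' : ContinuousOn F'.uncurry (s ×ˢ spectrum ℝ a)) {t₀ : ℝ} (ht₀ : t₀ ∈ s) :
    HasDerivAt (fun t => cfc (F t) a) (cfc (F' t₀) a) t₀ := by
  rw [hasDerivAt_iff_isLittleO, Asymptotics.isLittleO_iff]
  intro ε hε
  obtain ⟨v, hv, hvε⟩ := (ContinuousFunctionalCalculus.isCompact_spectrum a).mem_uniformity_of_prod
    hF' ht₀ (Metric.dist_mem_uniformity hε)
  rw [hs.nhdsWithin_eq ht₀] at hv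
  obtain ⟨δ, hδ, hball⟩ := Metric.mem_nhds_iff.1 (inter_mem hv (hs.mem_nhds ht₀))
  filter_upwards [Metric.ball_mem_nhds t₀ hδ] with t ht
  have hFt := hFc t (hball ht).2
  have hFt₀ := hFc t₀ ht₀
  have hF't₀ := continuousOn_uncurry_apply hF' ht₀
  rw [← cfc_sub (F t) (F t₀) a, ← cfc_const_mul (t - t₀) (F' t₀) a,
    ← cfc_sub (fun x => F t x - F t₀ x) (fun x => (t - t₀) * F' t₀ x) a]
  refine norm_cfc_le (by positivity) fun x hx => ?_
  have hderiv : ∀ r ∈ Metric.ball t₀ δ, HasDerivWithinAt (fun r => F r x - r * F' t₀ x)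
      (F' r x - 1 * F' t₀ x) (Metric.ball t₀ δ) r := fun r hr =>
    ((hF r (hball hr).2 x hx).fun_sub ((hasDerivAt_id' r).mul_const _)).hasDerivWithinAt
  have hmv := (convex_ball t₀ δ).norm_image_sub_le_of_norm_hasDerivWithin_le hderiv
    (fun r hr => by simpa only [one_mul] using (hvε r (hball hr).1 x hx).le)
    (Metric.mem_ball_self hδ) ht
  rwa [show F t x - F t₀ x - (t - t₀) * F' t₀ x =
    F t x - t * F' t₀ x - (F t₀ x - t₀ * F' t₀ x) by ring]

end FunctionalCalculus

section Symbol

/-- The symbol `y ↦ y e^{-t(y-1)}` read in the variable `x = 1 / y`. In the continuous functional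
calculus it turns the resolvent `(1 + A)⁻¹` into `(1 + A) e^{-tA}`. The convention `0⁻¹ = 0` gives
it the value at `x = 0` that makes it continuous for `0 < t`. -/
def heatSymbol (t x : ℝ) : ℝ := x⁻¹ * Real.exp (t * (1 - x⁻¹))

theorem heatSymbol_nonneg (t : ℝ) {x : ℝ} (hx : 0 ≤ x) : 0 ≤ heatSymbol t x := by
  unfold heatSymbol; positivity

theorem heatSymbol_le {t x : ℝ} (ht : 0 < t) (hx : 0 ≤ x) :
    heatSymbol t x ≤ 2 * Real.exp t / t ^ 2 * x := by
  rcases hx.eq_or_lt with rfl | hx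
  · simp [heatSymbol]
  have hquad : (t * x⁻¹) ^ 2 / 2 ≤ Real.exp (t * x⁻¹) := by
    have := Real.quadratic_le_exp_of_nonneg (x := t * x⁻¹) (by positivity)
    have : 0 < t * x⁻¹ := by positivity
    linarith
  calc heatSymbol t x
      = 2 * Real.exp t / t ^ 2 * x * ((t * x⁻¹) ^ 2 / 2) / Real.exp (t * x⁻¹) := by
        rw [heatSymbol, mul_one_sub, Real.exp_sub]; field_simp
    _ ≤ 2 * Real.exp t / t ^ 2 * x := div_le_of_le_mul₀ (by positivity) (by positivity) (by gcongr)

theorem continuousOn_heatSymbol :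
    ContinuousOn heatSymbol.uncurry (Ioi 0 ×ˢ Icc 0 1) := by
  rintro ⟨t, x⟩ ⟨ht : 0 < t, hx, -⟩
  rcases hx.eq_or_lt with rfl | hx
  · have hbound : Tendsto (fun q : ℝ × ℝ => 2 * Real.exp q.1 / q.1 ^ 2 * q.2)
        (𝓝[Ioi 0 ×ˢ Icc 0 1] (t, 0)) (𝓝 0) := by
      have : ContinuousAt (fun q : ℝ × ℝ => 2 * Real.exp q.1 / q.1 ^ 2 * q.2) (t, 0) := by
        have : t ^ 2 ≠ 0 := by positivity
        fun_prop (disch := assumption)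
      simpa using this.tendsto.mono_left nhdsWithin_le_nhds
    simp only [ContinuousWithinAt, Function.uncurry, heatSymbol, inv_zero, zero_mul]
    refine squeeze_zero' ?_ ?_ hbound <;> filter_upwards [self_mem_nhdsWithin] with q hq
    · exact heatSymbol_nonneg q.1 hq.2.1
    · exact heatSymbol_le hq.1 hq.2.1
  · have : x ≠ 0 := hx.ne'
    apply ContinuousAt.continuousWithinAt
    unfold Function.uncurry heatSymbol
    fun_prop (disch := assumption)

theorem hasDerivAt_mul_heatSymbol (t x : ℝ) :
    HasDerivAt (fun t => x * heatSymbol t x) (x * heatSymbol t x - heatSymbol t x) t := by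
  have hexp : HasDerivAt (fun t => x * (x⁻¹ * Real.exp (t * (1 - x⁻¹))))
      (x * (x⁻¹ * (Real.exp (t * (1 - x⁻¹)) * (1 * (1 - x⁻¹))))) t :=
    (((hasDerivAt_id t).mul_const _).exp.const_mul _).const_mul _
  refine hexp.congr_deriv ?_
  rcases eq_or_ne x 0 with rfl | hx
  · simp [heatSymbol]
  · simp only [heatSymbol]; field_simp

theorem mul_heatSymbol_le_one {t x : ℝ} (ht : 0 ≤ t) (hx : x ∈ Icc (0 : ℝ) 1) :
    x * heatSymbol t x ≤ 1 := by
  rcases hx.1.eq_or_lt with rfl | hx0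
  · simp
  · rw [heatSymbol, mul_inv_cancel_left₀ hx0.ne', Real.exp_le_one_iff]
    exact mul_nonpos_of_nonneg_of_nonpos ht (sub_nonpos.2 (one_le_inv₀ hx0 |>.2 hx.2))

theorem abs_mul_heatSymbol_mul_sub_le {t x : ℝ} (ht : 0 ≤ t) (hx : x ∈ Icc (0 : ℝ) 1) :
    |x * heatSymbol t x * x - x| ≤ t := by
  have hle : x * heatSymbol t x * x ≤ x :=
    mul_le_of_le_one_left hx.1 (mul_heatSymbol_le_one ht hx)
  rw [abs_sub_comm, abs_of_nonneg (sub_nonneg.2 hle)]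
  rcases hx.1.eq_or_lt with rfl | hx0
  · simpa
  · calc x - x * heatSymbol t x * x = x * (1 - Real.exp (t * (1 - x⁻¹))) := by
          rw [heatSymbol]; field_simp
      _ ≤ x * -(t * (1 - x⁻¹)) := by
          gcongr; linarith [Real.add_one_le_exp (t * (1 - x⁻¹))]
      _ = t * (1 - x) := by field_simp; ring
      _ ≤ t := by nlinarith

/-- With `y = 1 / x` this is `(y - 1) e^{-2t(y-1)} ≤ 1 / t`. -/
theorem heatSymbol_mul_sub_mul_le {t x : ℝ} (ht : 0 < t) (hx : x ∈ Icc (0 : ℝ) 1) :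
    heatSymbol t x * (x - x * x) * heatSymbol t x ≤ t⁻¹ := by
  rcases hx.1.eq_or_lt with rfl | hx0
  · simpa using ht.le
  set z := x⁻¹ - 1 with hz
  have hz0 : 0 ≤ z := sub_nonneg.2 (one_le_inv₀ hx0 |>.2 hx.2)
  have hexp : t * z ≤ Real.exp (t * z) ^ 2 := by
    nlinarith [Real.add_one_le_exp (t * z), Real.one_le_exp (mul_nonneg ht.le hz0)]
  calc heatSymbol t x * (x - x * x) * heatSymbol t x
      = z / Real.exp (t * z) ^ 2 := by
        rw [heatSymbol, show t * (1 - x⁻¹) = -(t * z) by ring, Real.exp_neg, hz]; field_simp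
    _ ≤ t⁻¹ := by
        rw [div_le_iff₀ (by positivity), inv_mul_eq_div, le_div_iff₀ ht, mul_comm]; exact hexp

end Symbol

section Semigroup

variable {H : Type*} [NormedAddCommGroup H] [InnerProductSpace ℂ H] [CompleteSpace H]

/-- `J` is the resolvent `(1 + A)⁻¹` of a nonnegative self-adjoint, possibly unbounded, operator
`A` on `H`; the domain of `A` is the range of `J`. -/
structure IsResolvent (J : H →L[ℂ] H) : Prop where
  nonneg : 0 ≤ J
  le_one : J ≤ 1
  injective : Function.Injective J

/-- The operator `(1 + A) e^{-tA}`, for `J = (1 + A)⁻¹` and `0 < t`. -/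
def smoothing (J : H →L[ℂ] H) (t : ℝ) : H →L[ℂ] H := cfc (heatSymbol t) J

/-- The operator `e^{-tA}`, for `J = (1 + A)⁻¹` and `0 ≤ t`. -/
def semigroup (J : H →L[ℂ] H) (t : ℝ) : H →L[ℂ] H := if t ≤ 0 then 1 else J * smoothing J t

theorem semigroup_zero (J : H →L[ℂ] H) : semigroup J 0 = 1 := if_pos le_rfl

theorem semigroup_of_pos (J : H →L[ℂ] H) {t : ℝ} (ht : 0 < t) :
    semigroup J t = J * smoothing J t := if_neg ht.not_ge

namespace IsResolvent

variable {J J₀ B b : H →L[ℂ] H} {t : ℝ}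

theorem spectrum_subset (hJ : IsResolvent J) : spectrum ℝ J ⊆ Icc 0 1 := fun x hx =>
  ⟨spectrum_nonneg_of_nonneg hJ.nonneg hx,
    (le_algebraMap_iff_spectrum_le (IsSelfAdjoint.of_nonneg hJ.nonneg)).1
      (by simpa using hJ.le_one) x hx⟩

theorem denseRange (hJ : IsResolvent J) : DenseRange J := by
  have hker : J.rangeᗮ = ⊥ := by
    rw [ContinuousLinearMap.orthogonal_range, ← ContinuousLinearMap.star_eq_adjoint,
      (IsSelfAdjoint.of_nonneg hJ.nonneg).star_eq, LinearMap.ker_eq_bot]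
    exact hJ.injective
  exact Submodule.dense_iff_topologicalClosure_eq_top.2
    (Submodule.topologicalClosure_eq_top_iff.2 hker)

/-- If `J₀ = (1 + A)⁻¹` then `J = (1 + A + B)⁻¹`. With `R = J₀^{1/2}` it is
`R (1 + R B R)⁻¹ R`. -/
theorem exists_perturbation (hJ₀ : IsResolvent J₀) (hB : 0 ≤ B) :
    ∃ J, IsResolvent J ∧ J = J₀ * (1 - B * J) := by
  set R := CFC.sqrt J₀
  have hR : 0 ≤ R := CFC.sqrt_nonneg J₀
  have hRR : R * R = J₀ := CFC.sqrt_mul_sqrt_self J₀ hJ₀.nonneg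
  have hM : 1 ≤ 1 + R * B * R := le_add_of_nonneg_right (conjugate_nonneg_of_nonneg hB hR)
  obtain ⟨M, hMeq⟩ := CStarAlgebra.isUnit_of_le 1 hM
  rw [← hMeq] at hM
  have hMinv : ((M⁻¹ : (H →L[ℂ] H)ˣ) : H →L[ℂ] H) = 1 - R * B * R * (M⁻¹ : (H →L[ℂ] H)ˣ) := by
    rw [eq_sub_iff_add_eq, ← one_add_mul, ← hMeq, Units.mul_inv]
  have hMinv_nonneg : (0 : H →L[ℂ] H) ≤ (M⁻¹ : (H →L[ℂ] H)ˣ) :=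
    CFC.inv_nonneg_of_nonneg M (zero_le_one.trans hM)
  have hRinj : Function.Injective R := fun f g hfg => hJ₀.injective <| by
    simp only [← hRR, mul_apply_eq_comp, hfg]
  refine ⟨R * (M⁻¹ : (H →L[ℂ] H)ˣ) * R, ⟨conjugate_nonneg_of_nonneg hMinv_nonneg hR, ?_, ?_⟩, ?_⟩
  · calc R * (M⁻¹ : (H →L[ℂ] H)ˣ) * R
        ≤ R * 1 * R := conjugate_le_conjugate_of_nonneg (CStarAlgebra.inv_le_one hM) hR
      _ = J₀ := by rw [mul_one, hRR]
      _ ≤ 1 := hJ₀.le_one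
  · have hMinj : Function.Injective ((M⁻¹ : (H →L[ℂ] H)ˣ) : H →L[ℂ] H) := fun f g hfg => by
      simpa [← mul_apply_eq_comp] using congr((M : H →L[ℂ] H) $hfg)
    exact (hRinj.comp hMinj).comp hRinj
  · conv_lhs => rw [hMinv]
    rw [← hRR]; noncomm_ring

/-- With `A = A₀ + B` this is `J B J ≤ J A J = J (J⁻¹ - 1) J`. -/
theorem mul_mul_le (hJ : IsResolvent J) (hJ₀ : IsResolvent J₀)
    (h : J = J₀ * (1 - B * J)) : J * B * J ≤ J - J * J := by
  have hstar : J = star (1 - B * J) * J₀ := by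
    conv_lhs => rw [← (IsSelfAdjoint.of_nonneg hJ.nonneg).star_eq, h]
    rw [star_mul, (IsSelfAdjoint.of_nonneg hJ₀.nonneg).star_eq]
  have hsq : J₀ * J₀ ≤ J₀ := by
    simpa only [sq, pow_one] using CStarAlgebra.pow_antitone hJ₀.nonneg hJ₀.le_one one_le_two
  have hkey : J - J * J - J * B * J = star (1 - B * J) * (J₀ - J₀ * J₀) * (1 - B * J) :=
    calc J - J * J - J * B * J = J * (1 - B * J) - J * J := by noncomm_ring
      _ = star (1 - B * J) * J₀ * (1 - B * J) - star (1 - B * J) * J₀ * (J₀ * (1 - B * J)) := by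
        rw [← hstar, ← h]
      _ = star (1 - B * J) * (J₀ - J₀ * J₀) * (1 - B * J) := by noncomm_ring
  rw [← sub_nonneg, hkey]
  exact star_left_conjugate_nonneg (sub_nonneg.2 hsq) _

theorem continuousOn_uncurry_heatSymbol (hJ : IsResolvent J) :
    ContinuousOn heatSymbol.uncurry (Ioi 0 ×ˢ spectrum ℝ J) :=
  continuousOn_heatSymbol.mono (prod_mono_right hJ.spectrum_subset)

theorem continuousOn_heatSymbol (hJ : IsResolvent J) (ht : 0 < t) :
    ContinuousOn (heatSymbol t) (spectrum ℝ J) :=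
  continuousOn_uncurry_apply hJ.continuousOn_uncurry_heatSymbol ht

theorem continuousOn_smoothing (hJ : IsResolvent J) : ContinuousOn (smoothing J) (Ioi 0) :=
  continuousOn_cfc_of_continuousOn_uncurry J hJ.continuousOn_uncurry_heatSymbol

theorem semigroup_eq_cfc (hJ : IsResolvent J) (ht : 0 < t) :
    semigroup J t = cfc (fun x => x * heatSymbol t x) J := by
  have hc := hJ.continuousOn_heatSymbol ht
  have hsa : IsSelfAdjoint J := .of_nonneg hJ.nonneg
  rw [semigroup_of_pos J ht, smoothing, cfc_mul (fun x => x) (heatSymbol t) J, cfc_id' ℝ J]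

theorem hasDerivAt_semigroup (hJ : IsResolvent J) (ht : 0 < t) :
    HasDerivAt (semigroup J) (semigroup J t - smoothing J t) t := by
  have hc := hJ.continuousOn_uncurry_heatSymbol
  have hct := hJ.continuousOn_heatSymbol ht
  have hxc : ContinuousOn (fun q : ℝ × ℝ => q.2 * heatSymbol.uncurry q - heatSymbol.uncurry q)
      (Ioi 0 ×ˢ spectrum ℝ J) := by fun_prop
  have hderiv := hasDerivAt_cfc (F := fun t x => x * heatSymbol t x)
    (F' := fun t x => x * heatSymbol t x - heatSymbol t x) isOpen_Ioi
    (fun t _ x _ => hasDerivAt_mul_heatSymbol t x)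
    (fun t ht => continuousOn_id.mul (hJ.continuousOn_heatSymbol ht)) hxc ht
  rw [cfc_sub (fun x => x * heatSymbol t x) (heatSymbol t) J, ← hJ.semigroup_eq_cfc ht] at hderiv
  exact hderiv.congr_of_eventuallyEq <|
    (eventually_gt_nhds ht).mono fun r hr => hJ.semigroup_eq_cfc hr

theorem hasDerivAt_semigroup_apply (hJ : IsResolvent J) (f : H) (ht : 0 < t) :
    HasDerivAt (fun t => semigroup J t f) (semigroup J t f - smoothing J t f) t :=
  ((ContinuousLinearMap.apply ℂ H f).restrictScalars ℝ).hasFDerivAt.comp_hasDerivAt t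
    (hJ.hasDerivAt_semigroup ht)

theorem isSelfAdjoint_smoothing : IsSelfAdjoint (smoothing J t) := cfc_predicate _ _

theorem isSelfAdjoint_semigroup (hJ : IsResolvent J) (ht : 0 < t) :
    IsSelfAdjoint (semigroup J t) := by
  rw [hJ.semigroup_eq_cfc ht]; exact cfc_predicate _ _

theorem norm_semigroup_le_one (hJ : IsResolvent J) (t : ℝ) : ‖semigroup J t‖ ≤ 1 := by
  rcases le_or_gt t 0 with ht | ht
  · rw [semigroup, if_pos ht]; exact ContinuousLinearMap.norm_id_le
  · rw [hJ.semigroup_eq_cfc ht]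
    refine norm_cfc_le zero_le_one fun x hx => ?_
    have hx' := hJ.spectrum_subset hx
    rw [Real.norm_of_nonneg (mul_nonneg hx'.1 (heatSymbol_nonneg t hx'.1))]
    exact mul_heatSymbol_le_one ht.le hx'

theorem norm_semigroup_mul_sub_le (hJ : IsResolvent J) (ht : 0 < t) :
    ‖semigroup J t * J - J‖ ≤ t := by
  have hsa : IsSelfAdjoint J := .of_nonneg hJ.nonneg
  have hc := hJ.continuousOn_heatSymbol ht
  have hcfc : cfc (fun x => x * heatSymbol t x * x - x) J = semigroup J t * J - J := by
    rw [cfc_sub (fun x => x * heatSymbol t x * x) (fun x => x) J,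
      cfc_mul (fun x => x * heatSymbol t x) (fun x => x) J, cfc_id' ℝ J, hJ.semigroup_eq_cfc ht]
  rw [← hcfc]
  exact norm_cfc_le ht.le fun x hx => abs_mul_heatSymbol_mul_sub_le ht.le (hJ.spectrum_subset hx)

theorem continuousOn_semigroup_mul (hJ : IsResolvent J) :
    ContinuousOn (fun t => semigroup J t * J) (Ici 0) := by
  intro t (ht : 0 ≤ t)
  rcases ht.eq_or_lt with rfl | ht
  · refine tendsto_iff_norm_sub_tendsto_zero.2 <| squeeze_zero' (.of_forall fun _ => norm_nonneg _)
      (eventually_mem_nhdsWithin.mono fun t (ht : 0 ≤ t) => ?_)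
      (tendsto_id'.2 nhdsWithin_le_nhds)
    change ‖semigroup J t * J - semigroup J 0 * J‖ ≤ t
    rw [semigroup_zero, one_mul]
    rcases ht.eq_or_lt with rfl | ht
    · simp [semigroup_zero]
    · exact hJ.norm_semigroup_mul_sub_le ht
  · exact ((hJ.hasDerivAt_semigroup ht).continuousAt.mul_const J).continuousWithinAt

theorem continuousOn_semigroup_apply (hJ : IsResolvent J) (f : H) :
    ContinuousOn (fun t => semigroup J t f) (Ici 0) := by
  refine continuousOn_of_uniform_approx_of_continuousOn fun u hu => ?_
  obtain ⟨ε, hε, hεu⟩ := Metric.mem_uniformity_dist.1 hu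
  obtain ⟨g, hg⟩ := hJ.denseRange.exists_dist_lt f hε
  refine ⟨fun t => (semigroup J t * J) g,
    hJ.continuousOn_semigroup_mul.clm_apply continuousOn_const, fun t _ => hεu ?_⟩
  calc dist (semigroup J t f) (semigroup J t (J g)) = ‖semigroup J t (f - J g)‖ := by
        rw [map_sub, dist_eq_norm]
    _ ≤ ‖f - J g‖ := (semigroup J t).le_of_opNorm_le_of_le (hJ.norm_semigroup_le_one t) le_rfl
        |>.trans_eq (one_mul _)
    _ < ε := by rwa [← dist_eq_norm]

theorem smoothing_mul_mul_smoothing_le (hJ : IsResolvent J) (ht : 0 < t) :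
    smoothing J t * (J - J * J) * smoothing J t ≤ algebraMap ℝ (H →L[ℂ] H) t⁻¹ := by
  have hsa : IsSelfAdjoint J := .of_nonneg hJ.nonneg
  have hc := hJ.continuousOn_heatSymbol ht
  have hcfc : cfc (fun x => heatSymbol t x * (x - x * x) * heatSymbol t x) J =
      smoothing J t * (J - J * J) * smoothing J t := by
    rw [cfc_mul (fun x => heatSymbol t x * (x - x * x)) (heatSymbol t) J,
      cfc_mul (heatSymbol t) (fun x => x - x * x) J, cfc_sub (fun x => x) (fun x => x * x) J,
      cfc_mul (fun x => x) (fun x => x) J, cfc_id' ℝ J, smoothing]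
  rw [← hcfc]
  exact cfc_le_algebraMap _ _ J fun x hx => heatSymbol_mul_sub_mul_le ht (hJ.spectrum_subset hx)

theorem semigroup_eq_smoothing_mul (hJ : IsResolvent J) (ht : 0 < t) :
    semigroup J t = smoothing J t * J := by
  have hcomm : Commute (cfc (fun x : ℝ => x) J) (smoothing J t) := cfc_commute_cfc _ _ J
  rw [cfc_id' ℝ J (.of_nonneg hJ.nonneg)] at hcomm
  rw [semigroup_of_pos J ht, hcomm.eq]

theorem semigroup_mul_mul_semigroup_le (hJ : IsResolvent J) (hB : J * B * J ≤ J - J * J)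
    (ht : 0 < t) :
    semigroup J t * B * semigroup J t ≤ algebraMap ℝ (H →L[ℂ] H) t⁻¹ :=
  calc semigroup J t * B * semigroup J t = smoothing J t * (J * B * J) * smoothing J t := by
        nth_rw 1 [hJ.semigroup_eq_smoothing_mul ht]
        rw [semigroup_of_pos J ht]; noncomm_ring
    _ ≤ smoothing J t * (J - J * J) * smoothing J t :=
        isSelfAdjoint_smoothing.conjugate_le_conjugate hB
    _ ≤ algebraMap ℝ (H →L[ℂ] H) t⁻¹ := hJ.smoothing_mul_mul_smoothing_le ht

theorem mul_sq_norm_semigroup_apply_le (hJ : IsResolvent J) (hb : IsSelfAdjoint b)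
    (hbJ : J * (b * b) * J ≤ J - J * J) (ht : 0 ≤ t) (f : H) :
    t * ‖semigroup J t (b f)‖ ^ 2 ≤ ‖f‖ ^ 2 := by
  rcases ht.eq_or_lt with rfl | ht
  · simp
  set S := semigroup J t
  have hS : star (S * b) = b * S := by
    rw [star_mul, (hJ.isSelfAdjoint_semigroup ht).star_eq, hb.star_eq]
  have hnorm : ‖S * b‖ ^ 2 ≤ t⁻¹ :=
    calc ‖S * b‖ ^ 2 = ‖S * b * star (S * b)‖ := by rw [CStarRing.norm_self_mul_star, sq]
      _ ≤ t⁻¹ := by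
        rw [CStarAlgebra.norm_le_iff_le_algebraMap _ (by positivity) (mul_star_self_nonneg _), hS,
          mul_assoc, ← mul_assoc b, ← mul_assoc]
        exact hJ.semigroup_mul_mul_semigroup_le hbJ ht
  calc t * ‖S (b f)‖ ^ 2 ≤ t * (‖S * b‖ * ‖f‖) ^ 2 := by gcongr; exact (S * b).le_opNorm f
    _ = t * ‖S * b‖ ^ 2 * ‖f‖ ^ 2 := by ring
    _ ≤ t * t⁻¹ * ‖f‖ ^ 2 := by gcongr
    _ = ‖f‖ ^ 2 := by rw [mul_inv_cancel₀ ht.ne', one_mul]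

end IsResolvent

end Semigroup

section Multiplication

variable {α : Type*} [MeasurableSpace α] {μ : Measure α} {m m' : α → ℂ}

/-- The bounded operator on `L²(μ; ℂ)` of multiplication by an essentially bounded function. -/
def mulOp (hm : MemLp m ∞ μ) : Lp ℂ 2 μ →L[ℂ] Lp ℂ 2 μ :=
  (ContinuousLinearMap.mul ℂ ℂ).holderL μ ∞ 2 2 hm.toLp

theorem coeFn_mulOp (hm : MemLp m ∞ μ) (f : Lp ℂ 2 μ) : mulOp hm f =ᵐ[μ] fun x => m x * f x := by
  filter_upwards [(ContinuousLinearMap.mul ℂ ℂ).coeFn_holder (r := 2) hm.toLp f, hm.coeFn_toLp]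
    with x hx hmx
  rw [← hmx]
  exact hx

theorem mulOp_mul_mulOp (hm : MemLp m ∞ μ) (hm' : MemLp m' ∞ μ)
    (hmm' : MemLp (fun x => m x * m' x) ∞ μ) : mulOp hm * mulOp hm' = mulOp hmm' := by
  ext1 f
  refine Lp.ext ?_
  filter_upwards [coeFn_mulOp hm (mulOp hm' f), coeFn_mulOp hm' f, coeFn_mulOp hmm' f]
    with x h h' hh'
  rw [mul_apply_eq_comp, h, h', hh', mul_assoc]

theorem one_sub_mulOp (hm : MemLp m ∞ μ) (hm' : MemLp (fun x => 1 - m x) ∞ μ) :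
    1 - mulOp hm = mulOp hm' := by
  ext1 f
  refine Lp.ext ?_
  filter_upwards [Lp.coeFn_sub f (mulOp hm f), coeFn_mulOp hm f, coeFn_mulOp hm' f]
    with x hsub h h'
  rw [sub_apply, one_apply_eq_self, hsub, Pi.sub_apply, h, h', sub_mul, one_mul]

theorem mulOp_nonneg (hm : MemLp m ∞ μ) (h : 0 ≤ m) : 0 ≤ mulOp hm := by
  rw [ContinuousLinearMap.nonneg_iff_isPositive, ContinuousLinearMap.isPositive_iff_complex]
  intro f
  have hnonneg : 0 ≤ ⟪mulOp hm f, f⟫_ℂ := by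
    rw [L2.inner_def]
    refine integral_nonneg_of_ae ?_
    filter_upwards [coeFn_mulOp hm f] with x hx
    rw [hx, ← smul_eq_mul, inner_smul_left]
    have hinner : 0 ≤ ⟪f x, f x⟫_ℂ := by rw [inner_self_eq_norm_sq_to_K]; positivity
    exact mul_nonneg (star_nonneg_iff.2 (h x)) hinner
  rw [RCLike.nonneg_iff] at hnonneg
  exact ⟨RCLike.conj_eq_iff_re.1 (RCLike.conj_eq_iff_im.2 hnonneg.2), hnonneg.1⟩

theorem mulOp_le_one (hm : MemLp m ∞ μ) (h : m ≤ 1) : mulOp hm ≤ 1 := by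
  have hm' : MemLp (fun x => 1 - m x) ∞ μ := (memLp_top_const 1).sub hm
  rw [← sub_nonneg, one_sub_mulOp hm hm']
  exact mulOp_nonneg hm' fun x => sub_nonneg.2 (h x)

end Multiplication

section FourierMultiplier

variable {E : Type*} [NormedAddCommGroup E] [InnerProductSpace ℝ E]

/-- The symbol of the directional derivative `∂ᵥ`. -/
def lineDerivSymbol (v ξ : E) : ℂ := 2 * Real.pi * Complex.I * ⟪ξ, v⟫_ℝ

theorem continuous_lineDerivSymbol (v : E) : Continuous (lineDerivSymbol v) := by
  unfold lineDerivSymbol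
  fun_prop

variable [FiniteDimensional ℝ E] [MeasurableSpace E] [BorelSpace E] {m : E → ℂ}

/-- The complex Hilbert space `L²(E; ℂ)` for the Lebesgue measure. -/
abbrev L2C (E : Type*) [NormedAddCommGroup E] [InnerProductSpace ℝ E] [FiniteDimensional ℝ E]
    [MeasurableSpace E] [BorelSpace E] : Type _ := Lp ℂ 2 (volume : Measure E)

/-- The Fourier multiplier on `L²(E; ℂ)` with essentially bounded symbol `m`. -/
def fourierMul (hm : MemLp m ∞ volume) : L2C E →L[ℂ] L2C E :=
  (Lp.fourierTransformₗᵢ E ℂ).symm.conjStarAlgEquiv (mulOp hm)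

theorem fourier_fourierMul (hm : MemLp m ∞ volume) (f : L2C E) :
    𝓕 (fourierMul hm f) = mulOp hm (𝓕 f) :=
  FourierTransform.fourier_fourierInv_eq _

theorem coeFn_fourier_fourierMul (hm : MemLp m ∞ volume) (f : L2C E) :
    ⇑(𝓕 (fourierMul hm f) : L2C E) =ᵐ[volume] fun ξ => m ξ * (𝓕 f : L2C E) ξ := by
  rw [fourier_fourierMul]
  exact coeFn_mulOp hm (𝓕 f)

theorem fourierMul_nonneg (hm : MemLp m ∞ (volume : Measure E)) (h : 0 ≤ m) : 0 ≤ fourierMul hm :=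
  map_nonneg _ (mulOp_nonneg hm h)

theorem fourierMul_le_one (hm : MemLp m ∞ (volume : Measure E)) (h : m ≤ 1) :
    fourierMul hm ≤ 1 := by
  rw [← map_one (Lp.fourierTransformₗᵢ E ℂ).symm.conjStarAlgEquiv]
  exact OrderHomClass.mono _ (mulOp_le_one hm h)

theorem fourierMul_injective (hm : MemLp m ∞ (volume : Measure E)) (h : ∀ ξ, m ξ ≠ 0) :
    Function.Injective (fourierMul hm) := by
  intro f g hfg
  refine (Lp.fourierTransformₗᵢ E ℂ).injective (Lp.ext ?_)
  have hf := coeFn_fourier_fourierMul hm f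
  rw [hfg] at hf
  filter_upwards [hf, coeFn_fourier_fourierMul hm g] with ξ hf hg
  exact mul_left_cancel₀ (h ξ) (hf.symm.trans hg)

theorem fourier_lineDerivOp_toTemperedDistribution_apply (f : L2C E) (v : E) (ψ : 𝓢(E, ℂ)) :
    𝓕 (∂_{v} (f : 𝓢'(E, ℂ))) ψ = ∫ ξ, ψ ξ * (lineDerivSymbol v ξ * (𝓕 f : L2C E) ξ) := by
  rw [fourier_lineDerivOp_eq, Lp.fourier_toTemperedDistribution_eq, smul_apply,
    smulLeftCLM_apply_apply, Lp.toTemperedDistribution_apply, ← integral_smul]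
  refine integral_congr_ae (Eventually.of_forall fun ξ => ?_)
  have hgrowth : (fun ξ : E => (⟪ξ, v⟫_ℝ : ℂ)).HasTemperateGrowth := by fun_prop
  simp only [SchwartzMap.smulLeftCLM_apply_apply hgrowth, lineDerivSymbol, smul_eq_mul]
  ring

theorem lineDerivOp_toTemperedDistribution_eq_iff (f g : L2C E) (v : E) :
    ∂_{v} (f : 𝓢'(E, ℂ)) = (g : 𝓢'(E, ℂ)) ↔
      ⇑(𝓕 g : L2C E) =ᵐ[volume] fun ξ => lineDerivSymbol v ξ * (𝓕 f : L2C E) ξ := by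
  constructor
  · intro h
    refine ae_eq_of_integral_contDiff_smul_eq ((Lp.memLp _).locallyIntegrable one_le_two)
      (((Lp.memLp _).locallyIntegrable one_le_two).continuous_mul (continuous_lineDerivSymbol v))
      fun φ hφ hc => ?_
    let ψ : 𝓢(E, ℂ) := (hc.comp_left (g := Complex.ofReal) rfl).toSchwartzMap
      (Complex.ofRealCLM.contDiff.comp hφ)
    have hψ := fourier_lineDerivOp_toTemperedDistribution_apply f v ψ
    rw [h, Lp.fourier_toTemperedDistribution_eq, Lp.toTemperedDistribution_apply] at hψ
    exact hψ
  · intro h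
    rw [← (FourierTransform.fourierEquiv ℂ 𝓢'(E, ℂ)).injective.eq_iff]
    ext ψ
    rw [FourierTransform.fourierEquiv_apply, FourierTransform.fourierEquiv_apply,
      fourier_lineDerivOp_toTemperedDistribution_apply, Lp.fourier_toTemperedDistribution_eq,
      Lp.toTemperedDistribution_apply]
    refine integral_congr_ae ?_
    filter_upwards [h] with ξ hξ
    rw [hξ, smul_eq_mul]

theorem lineDerivOp_fourierMul (hm : MemLp m ∞ volume) {v : E}
    (hvm : MemLp (fun ξ => lineDerivSymbol v ξ * m ξ) ∞ volume) (f : L2C E) :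
    ∂_{v} (fourierMul hm f : 𝓢'(E, ℂ)) = (fourierMul hvm f : 𝓢'(E, ℂ)) := by
  rw [lineDerivOp_toTemperedDistribution_eq_iff]
  filter_upwards [coeFn_fourier_fourierMul hm f, coeFn_fourier_fourierMul hvm f] with ξ h hv
  rw [hv, h, mul_assoc]

end FourierMultiplier

section Cutoff

theorem tendsto_integral_mul_of_bounded {α : Type*} [MeasurableSpace α] {μ : Measure α}
    {F : α → ℝ} {c : ℕ → α → ℝ} {a M : ℝ} (hF : Integrable F μ)
    (hc : ∀ k, AEStronglyMeasurable (c k) μ) (hM : ∀ k x, ‖c k x‖ ≤ M)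
    (ha : ∀ x, Tendsto (fun k => c k x) atTop (𝓝 a)) :
    Tendsto (fun k => ∫ x, c k x * F x ∂μ) atTop (𝓝 (a * ∫ x, F x ∂μ)) := by
  rw [← integral_const_mul]
  refine tendsto_integral_of_dominated_convergence (fun x => M * ‖F x‖)
    (fun k => (hc k).mul hF.aestronglyMeasurable) (hF.norm.const_mul M)
    (fun k => Eventually.of_forall fun x => ?_)
    (Eventually.of_forall fun x => (ha x).mul_const (F x))
  rw [norm_mul]
  exact mul_le_mul_of_nonneg_right (hM k x) (norm_nonneg _)

variable {E : Type*} [NormedAddCommGroup E] [NormedSpace ℝ E] [HasContDiffBump E]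

/-- Dilations of a smooth bump function; the `k`-th one is `1` on the ball of radius `k + 1`. -/
def cutoff (k : ℕ) (x : E) : ℝ :=
  (⟨1, 2, one_pos, one_lt_two⟩ : ContDiffBump (0 : E)) ((1 / ((k : ℝ) + 1)) • x)

theorem contDiff_cutoff (k : ℕ) : ContDiff ℝ ∞ (cutoff k : E → ℝ) :=
  (ContDiffBump.contDiff _).comp (contDiff_const_smul _)

theorem norm_cutoff_le_one (k : ℕ) (x : E) : ‖cutoff k x‖ ≤ 1 := by
  rw [cutoff, Real.norm_of_nonneg (ContDiffBump.nonneg _)]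
  exact ContDiffBump.le_one _

theorem tendsto_cutoff (x : E) : Tendsto (fun k => cutoff k x) atTop (𝓝 1) := by
  let χ : ContDiffBump (0 : E) := ⟨1, 2, one_pos, one_lt_two⟩
  have hx : Tendsto (fun k : ℕ => (1 / ((k : ℝ) + 1)) • x) atTop (𝓝 0) := by
    simpa only [zero_smul] using (tendsto_one_div_add_atTop_nhds_zero_nat (𝕜 := ℝ)).smul_const x
  rw [← χ.one_of_mem_closedBall (Metric.mem_closedBall_self χ.rIn_pos.le)]
  exact (χ.continuous.tendsto 0).comp hx

theorem hasCompactSupport_cutoff [FiniteDimensional ℝ E] (k : ℕ) :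
    HasCompactSupport (cutoff k : E → ℝ) :=
  (ContDiffBump.hasCompactSupport _).comp_homeomorph
    (Homeomorph.smulOfNeZero (1 / ((k : ℝ) + 1)) (by positivity))

theorem exists_norm_fderiv_cutoff_le [FiniteDimensional ℝ E] :
    ∃ M : ℝ, ∀ (k : ℕ) (x : E), ‖fderiv ℝ (cutoff k) x‖ ≤ 1 / ((k : ℝ) + 1) * M := by
  let χ : ContDiffBump (0 : E) := ⟨1, 2, one_pos, one_lt_two⟩
  obtain ⟨M, hM⟩ := (χ.hasCompactSupport.fderiv (𝕜 := ℝ)).exists_bound_of_continuous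
    ((χ.contDiff (n := 1)).continuous_fderiv one_ne_zero)
  refine ⟨M, fun k x => ?_⟩
  have hk : (0 : ℝ) ≤ 1 / ((k : ℝ) + 1) := by positivity
  unfold cutoff
  rw [fderiv_comp_smul, norm_smul, Real.norm_of_nonneg hk]
  exact mul_le_mul_of_nonneg_left (hM _) hk

variable [MeasurableSpace E] [BorelSpace E] {μ : Measure E} {F : E → ℝ}

theorem tendsto_integral_cutoff_mul (hF : Integrable F μ) :
    Tendsto (fun k => ∫ x, cutoff k x * F x ∂μ) atTop (𝓝 (∫ x, F x ∂μ)) := by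
  simpa only [one_mul] using tendsto_integral_mul_of_bounded hF
    (fun k => (contDiff_cutoff k).continuous.aestronglyMeasurable) norm_cutoff_le_one tendsto_cutoff

theorem tendsto_integral_fderiv_cutoff_mul [FiniteDimensional ℝ E] (hF : Integrable F μ) (v : E) :
    Tendsto (fun k => ∫ x, fderiv ℝ (cutoff k) x v * F x ∂μ) atTop (𝓝 0) := by
  obtain ⟨M, hM⟩ := exists_norm_fderiv_cutoff_le (E := E)
  have hbound (k : ℕ) (x : E) : ‖fderiv ℝ (cutoff k) x v‖ ≤ 1 / ((k : ℝ) + 1) * M * ‖v‖ :=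
    (fderiv ℝ (cutoff k) x).le_of_opNorm_le (hM k x) v
  have hM0 : 0 ≤ M := by simpa using (norm_nonneg _).trans (hM 0 0)
  have hlim : Tendsto (fun k : ℕ => 1 / ((k : ℝ) + 1) * M * ‖v‖) atTop (𝓝 0) := by
    simpa only [zero_mul] using
      ((tendsto_one_div_add_atTop_nhds_zero_nat (𝕜 := ℝ)).mul_const M).mul_const ‖v‖
  have hle (k : ℕ) (x : E) : ‖fderiv ℝ (cutoff k) x v‖ ≤ M * ‖v‖ := by
    refine (hbound k x).trans (mul_le_mul_of_nonneg_right ?_ (norm_nonneg v))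
    exact mul_le_of_le_one_left hM0 (div_le_one_of_le₀ (by linarith [k.cast_nonneg (α := ℝ)])
      (by positivity))
  simpa only [zero_mul] using tendsto_integral_mul_of_bounded hF
    (fun k => (((contDiff_cutoff k).continuous_fderiv (by simp)).clm_apply
      continuous_const).aestronglyMeasurable) hle
    fun x => squeeze_zero_norm (fun k => hbound k x) hlim

end Cutoff

section RealPart

variable {n : ℕ}

/-- The embedding of the real `L²(ℝⁿ)` into the complex one. -/
def ofRealL2 : L2 n →L[ℝ] L2C (EuclideanSpace ℝ (Fin n)) := Complex.ofRealCLM.compLpL 2 volume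

/-- The pointwise real part, from the complex `L²(ℝⁿ)` to the real one. -/
def reL2 : L2C (EuclideanSpace ℝ (Fin n)) →L[ℝ] L2 n := Complex.reCLM.compLpL 2 volume

theorem coeFn_ofRealL2 (f : L2 n) : ofRealL2 f =ᵐ[volume] fun x => (f x : ℂ) :=
  Complex.ofRealCLM.coeFn_compLpL f

theorem coeFn_reL2 (f : L2C (EuclideanSpace ℝ (Fin n))) : reL2 f =ᵐ[volume] fun x => (f x).re :=
  Complex.reCLM.coeFn_compLpL f

theorem reL2_ofRealL2 (f : L2 n) : reL2 (ofRealL2 f) = f := by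
  apply Lp.ext
  filter_upwards [coeFn_reL2 (ofRealL2 f), coeFn_ofRealL2 f] with x h1 h2
  rw [h1, h2, Complex.ofReal_re]

theorem norm_ofRealL2 (f : L2 n) : ‖ofRealL2 f‖ = ‖f‖ := by
  have h : ∀ᵐ x, ‖ofRealL2 f x‖ = ‖f x‖ := by
    filter_upwards [coeFn_ofRealL2 f] with x hx
    rw [hx, Complex.norm_real]
  exact le_antisymm (Lp.norm_le_norm_of_ae_le (h.mono fun _ hx => hx.le))
    (Lp.norm_le_norm_of_ae_le (h.mono fun _ hx => hx.ge))

theorem norm_reL2_le (f : L2C (EuclideanSpace ℝ (Fin n))) : ‖reL2 f‖ ≤ ‖f‖ := by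
  apply Lp.norm_le_norm_of_ae_le
  filter_upwards [coeFn_reL2 f] with x h
  rw [h]
  exact Complex.abs_re_le_norm _

theorem inner_ofRealL2 (f g : L2 n) : ⟪ofRealL2 f, ofRealL2 g⟫_ℂ = (⟪f, g⟫_ℝ : ℝ) := by
  rw [L2.inner_def, L2.inner_def, ← integral_complex_ofReal]
  refine integral_congr_ae ?_
  filter_upwards [coeFn_ofRealL2 f, coeFn_ofRealL2 g] with x h1 h2
  simp only [h1, h2, RCLike.inner_apply, Complex.conj_ofReal, conj_trivial, Complex.ofReal_mul]

end RealPart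

section WeakDerivative

variable {n : ℕ} {i : Fin n}

theorem HasWeakPartial.integral_eq_of_memLp {f g : L2 n} (h : HasWeakPartial i f g)
    {φ : EuclideanSpace ℝ (Fin n) → ℝ} (hφ : ContDiff ℝ ∞ φ) (h0 : MemLp φ 2 volume)
    (h1 : MemLp (fun x => fderiv ℝ φ x (EuclideanSpace.single i 1)) 2 volume) :
    ∫ x, f x * fderiv ℝ φ x (EuclideanSpace.single i 1) = -∫ x, g x * φ x := by
  unfold HasWeakPartial at h
  set e : EuclideanSpace ℝ (Fin n) := EuclideanSpace.single i 1
  have hfφ' : Integrable (fun x => f x * fderiv ℝ φ x e) := (Lp.memLp f).integrable_mul h1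
  have hfφ : Integrable (fun x => f x * φ x) := (Lp.memLp f).integrable_mul h0
  have hgφ : Integrable (fun x => g x * φ x) := (Lp.memLp g).integrable_mul h0
  have hleibniz (k : ℕ) (x : EuclideanSpace ℝ (Fin n)) :
      fderiv ℝ (fun x => cutoff k x * φ x) x e =
        cutoff k x * fderiv ℝ φ x e + fderiv ℝ (cutoff k) x e * φ x := by
    rw [fderiv_fun_mul ((contDiff_cutoff k).differentiable (by simp) x)
      (hφ.differentiable (by simp) x)]
    simp only [add_apply, smul_apply, smul_eq_mul, mul_comm (φ x)]
  have hcut (k : ℕ) : (∫ x, cutoff k x * (f x * fderiv ℝ φ x e)) +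
      ∫ x, fderiv ℝ (cutoff k) x e * (f x * φ x) = -∫ x, cutoff k x * (g x * φ x) := by
    have hk := h _ ((contDiff_cutoff k).mul hφ) ((hasCompactSupport_cutoff k).mul_right)
    simp only [hleibniz, mul_add, mul_left_comm _ (cutoff k _),
      mul_left_comm _ (fderiv ℝ (cutoff k) _ e)] at hk
    obtain ⟨M, hM⟩ := exists_norm_fderiv_cutoff_le (E := EuclideanSpace ℝ (Fin n))
    rw [← hk, integral_add (hfφ'.bdd_mul (contDiff_cutoff k).continuous.aestronglyMeasurable
      (Eventually.of_forall (norm_cutoff_le_one k)))]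
    exact hfφ.bdd_mul (((contDiff_cutoff k).continuous_fderiv (by simp)).clm_apply
      continuous_const).aestronglyMeasurable
      (Eventually.of_forall fun x => (fderiv ℝ (cutoff k) x).le_of_opNorm_le (hM k x) e)
  have hlim := (tendsto_integral_cutoff_mul hfφ').add (tendsto_integral_fderiv_cutoff_mul hfφ e)
  simp only [hcut, add_zero] at hlim
  exact tendsto_nhds_unique hlim (tendsto_integral_cutoff_mul hgφ).neg

theorem apply_ofRealL2_toTemperedDistribution (L : ℂ →L[ℝ] ℝ) (f : L2 n)
    (ψ : 𝓢(EuclideanSpace ℝ (Fin n), ℂ)) :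
    L ((ofRealL2 f : 𝓢'(EuclideanSpace ℝ (Fin n), ℂ)) ψ) = ∫ x, f x * L (ψ x) := by
  have hint : Integrable (fun x => ψ x • ofRealL2 f x) :=
    (ψ.memLp 2 volume).integrable_mul (Lp.memLp (ofRealL2 f))
  rw [Lp.toTemperedDistribution_apply, ← L.integral_comp_comm hint]
  refine integral_congr_ae ?_
  filter_upwards [coeFn_ofRealL2 f] with x hx
  rw [hx, smul_eq_mul, mul_comm, ← Complex.real_smul, map_smul, smul_eq_mul]

theorem HasWeakPartial.lineDerivOp_ofRealL2 {f g : L2 n} (h : HasWeakPartial i f g) :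
    ∂_{(EuclideanSpace.single i 1 : EuclideanSpace ℝ (Fin n))}
      (ofRealL2 f : 𝓢'(EuclideanSpace ℝ (Fin n), ℂ)) = ofRealL2 g := by
  ext ψ
  have hL (L : ℂ →L[ℝ] ℝ) :
      L (∂_{(EuclideanSpace.single i 1 : EuclideanSpace ℝ (Fin n))}
        (ofRealL2 f : 𝓢'(EuclideanSpace ℝ (Fin n), ℂ)) ψ) =
      L ((ofRealL2 g : 𝓢'(EuclideanSpace ℝ (Fin n), ℂ)) ψ) := by
    have hderiv (x : EuclideanSpace ℝ (Fin n)) :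
        fderiv ℝ (L ∘ ψ) x (EuclideanSpace.single i 1) =
          L (∂_{(EuclideanSpace.single i 1 : EuclideanSpace ℝ (Fin n))} ψ x) := by
      rw [SchwartzMap.lineDerivOp_apply_eq_fderiv,
        (L.hasFDerivAt.comp x ψ.differentiableAt.hasFDerivAt).fderiv]
      rfl
    have hint := h.integral_eq_of_memLp (L.contDiff.comp (ψ.smooth ⊤))
      (L.comp_memLp' (ψ.memLp 2 volume)) (by
        simp only [hderiv]
        exact L.comp_memLp' (SchwartzMap.memLp _ 2 volume))
    simp only [hderiv] at hint
    rw [lineDerivOp_apply_apply, map_neg, map_neg, apply_ofRealL2_toTemperedDistribution,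
      apply_ofRealL2_toTemperedDistribution, hint, neg_neg]
    rfl
  exact Complex.ext (hL Complex.reCLM) (hL Complex.imCLM)

theorem integral_reL2_mul {φ : EuclideanSpace ℝ (Fin n) → ℝ} {ψ : 𝓢(EuclideanSpace ℝ (Fin n), ℂ)}
    (hψ : ∀ x, ψ x = φ x) (f : L2C (EuclideanSpace ℝ (Fin n))) :
    ∫ x, reL2 f x * φ x = ((f : 𝓢'(EuclideanSpace ℝ (Fin n), ℂ)) ψ).re := by
  have hint : Integrable (fun x => ψ x • f x) := (ψ.memLp 2 volume).integrable_mul (Lp.memLp f)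
  rw [Lp.toTemperedDistribution_apply, ← Complex.reCLM_apply,
    ← Complex.reCLM.integral_comp_comm hint]
  refine integral_congr_ae ?_
  filter_upwards [coeFn_reL2 f] with x hx
  rw [hx, hψ, Complex.reCLM_apply, smul_eq_mul, Complex.re_ofReal_mul, mul_comm]

theorem hasWeakPartial_reL2 {f g : L2C (EuclideanSpace ℝ (Fin n))}
    (h : ∂_{(EuclideanSpace.single i 1 : EuclideanSpace ℝ (Fin n))}
      (f : 𝓢'(EuclideanSpace ℝ (Fin n), ℂ)) = (g : 𝓢'(EuclideanSpace ℝ (Fin n), ℂ))) :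
    HasWeakPartial i (reL2 f) (reL2 g) := by
  intro φ hφ hc
  set e : EuclideanSpace ℝ (Fin n) := EuclideanSpace.single i 1
  let ψ : 𝓢(EuclideanSpace ℝ (Fin n), ℂ) :=
    (hc.comp_left (g := Complex.ofReal) rfl).toSchwartzMap (Complex.ofRealCLM.contDiff.comp hφ)
  have hderiv (x : EuclideanSpace ℝ (Fin n)) : ∂_{e} ψ x = fderiv ℝ φ x e := by
    rw [SchwartzMap.lineDerivOp_apply_eq_fderiv]
    exact congrArg (fun T => T e) (Complex.ofRealCLM.hasFDerivAt.comp x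
      (hφ.differentiable (by simp) x).hasFDerivAt).fderiv
  rw [integral_reL2_mul hderiv, integral_reL2_mul (ψ := ψ) (fun _ => rfl), ← h,
    lineDerivOp_apply_apply, map_neg, Complex.neg_re, neg_neg]

theorem hasWeakPartial_iff_lineDerivOp_ofRealL2 {f g : L2 n} :
    HasWeakPartial i f g ↔ ∂_{(EuclideanSpace.single i 1 : EuclideanSpace ℝ (Fin n))}
      (ofRealL2 f : 𝓢'(EuclideanSpace ℝ (Fin n), ℂ)) = ofRealL2 g :=
  ⟨HasWeakPartial.lineDerivOp_ofRealL2,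
    fun h => by simpa only [reL2_ofRealL2] using hasWeakPartial_reL2 h⟩

end WeakDerivative

section FreeResolvent

variable {E : Type*} [NormedAddCommGroup E]

/-- The symbol `(1 + |2πξ|²)⁻¹` of the resolvent `(1 - Δ)⁻¹`. -/
def resolventSymbol (ξ : E) : ℂ := ((1 + (2 * Real.pi * ‖ξ‖) ^ 2)⁻¹ : ℝ)

theorem continuous_resolventSymbol : Continuous (resolventSymbol : E → ℂ) :=
  Complex.continuous_ofReal.comp <| Continuous.inv₀ (by fun_prop) fun ξ => by positivity

theorem resolventSymbol_ne_zero (ξ : E) : resolventSymbol ξ ≠ 0 :=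
  Complex.ofReal_ne_zero.2 (by positivity)

theorem resolventSymbol_nonneg : (0 : E → ℂ) ≤ resolventSymbol := fun ξ =>
  Complex.zero_le_real.2 (by positivity)

theorem resolventSymbol_le_one : (resolventSymbol : E → ℂ) ≤ 1 := fun ξ => by
  rw [resolventSymbol, Pi.one_apply, ← Complex.ofReal_one, Complex.real_le_real]
  exact inv_le_one_of_one_le₀ (le_add_of_nonneg_right (sq_nonneg _))

theorem norm_resolventSymbol (ξ : E) :
    ‖resolventSymbol ξ‖ = (1 + (2 * Real.pi * ‖ξ‖) ^ 2)⁻¹ := by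
  rw [resolventSymbol, Complex.norm_real, Real.norm_of_nonneg (by positivity)]

variable [InnerProductSpace ℝ E]

theorem norm_lineDerivSymbol_le (v ξ : E) :
    ‖lineDerivSymbol v ξ‖ ≤ 2 * Real.pi * ‖ξ‖ * ‖v‖ := by
  have hpi : ‖(2 * Real.pi * Complex.I : ℂ)‖ = 2 * Real.pi := by
    simp [abs_of_pos Real.pi_pos]
  rw [lineDerivSymbol, norm_mul, hpi, Complex.norm_real, mul_assoc (2 * Real.pi)]
  exact mul_le_mul_of_nonneg_left (norm_inner_le_norm ξ v) (by positivity)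

theorem norm_lineDerivSymbol_mul_resolventSymbol_le (v ξ : E) :
    ‖lineDerivSymbol v ξ * resolventSymbol ξ‖ ≤ ‖v‖ := by
  rw [norm_mul, norm_resolventSymbol, ← div_eq_mul_inv, div_le_iff₀ (by positivity)]
  refine (norm_lineDerivSymbol_le v ξ).trans ?_
  rw [mul_comm ‖v‖]
  refine mul_le_mul_of_nonneg_right ?_ (norm_nonneg v)
  nlinarith [sq_nonneg (2 * Real.pi * ‖ξ‖ - 1)]

theorem norm_lineDerivSymbol_mul_lineDerivSymbol_mul_resolventSymbol_le (v w ξ : E) :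
    ‖lineDerivSymbol w ξ * (lineDerivSymbol v ξ * resolventSymbol ξ)‖ ≤ ‖w‖ * ‖v‖ := by
  rw [norm_mul, norm_mul, norm_resolventSymbol, ← mul_assoc, ← div_eq_mul_inv,
    div_le_iff₀ (by positivity)]
  calc ‖lineDerivSymbol w ξ‖ * ‖lineDerivSymbol v ξ‖
      ≤ (2 * Real.pi * ‖ξ‖ * ‖w‖) * (2 * Real.pi * ‖ξ‖ * ‖v‖) :=
        mul_le_mul (norm_lineDerivSymbol_le w ξ) (norm_lineDerivSymbol_le v ξ) (norm_nonneg _)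
          (by positivity)
    _ = ‖w‖ * ‖v‖ * (2 * Real.pi * ‖ξ‖) ^ 2 := by ring
    _ ≤ ‖w‖ * ‖v‖ * (1 + (2 * Real.pi * ‖ξ‖) ^ 2) := by
        gcongr
        exact le_add_of_nonneg_left zero_le_one

theorem sum_lineDerivSymbol_mul_self_mul_resolventSymbol {ι : Type*} [Fintype ι]
    (b : OrthonormalBasis ι ℝ E) (ξ : E) :
    ∑ i, lineDerivSymbol (b i) ξ * (lineDerivSymbol (b i) ξ * resolventSymbol ξ) =
      resolventSymbol ξ - 1 := by
  have hsum : ∑ i, lineDerivSymbol (b i) ξ * lineDerivSymbol (b i) ξ =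
      -((2 * Real.pi * ‖ξ‖) ^ 2 : ℝ) := by
    have hsq (i : ι) : lineDerivSymbol (b i) ξ * lineDerivSymbol (b i) ξ =
        -((2 * Real.pi) ^ 2 * ⟪ξ, b i⟫_ℝ ^ 2 : ℝ) := by
      rw [lineDerivSymbol]
      push_cast
      linear_combination (2 * Real.pi * ⟪ξ, b i⟫_ℝ : ℂ) ^ 2 * Complex.I_sq
    rw [Finset.sum_congr rfl fun i _ => hsq i, Finset.sum_neg_distrib, ← Complex.ofReal_sum,
      ← Finset.mul_sum, b.sum_sq_inner_left, ← mul_pow]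
  have hinv : (1 + (2 * Real.pi * ‖ξ‖) ^ 2 : ℝ) * resolventSymbol ξ = 1 := by
    rw [resolventSymbol, ← Complex.ofReal_mul, mul_inv_cancel₀ (by positivity), Complex.ofReal_one]
  simp only [← mul_assoc]
  rw [← Finset.sum_mul, hsum]
  push_cast at hinv ⊢
  linear_combination -hinv

variable [FiniteDimensional ℝ E] [MeasurableSpace E] [BorelSpace E]

theorem memLp_resolventSymbol : MemLp (resolventSymbol : E → ℂ) ∞ volume :=
  memLp_top_of_bound continuous_resolventSymbol.aestronglyMeasurable 1 <| .of_forall fun ξ => by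
    rw [norm_resolventSymbol]
    exact inv_le_one_of_one_le₀ (le_add_of_nonneg_right (sq_nonneg _))

theorem memLp_lineDerivSymbol_mul_resolventSymbol (v : E) :
    MemLp (fun ξ => lineDerivSymbol v ξ * resolventSymbol ξ) ∞ volume :=
  memLp_top_of_bound
    ((continuous_lineDerivSymbol v).mul continuous_resolventSymbol).aestronglyMeasurable _
    (.of_forall (norm_lineDerivSymbol_mul_resolventSymbol_le v))

theorem memLp_lineDerivSymbol_mul_lineDerivSymbol_mul_resolventSymbol (v w : E) :
    MemLp (fun ξ => lineDerivSymbol w ξ * (lineDerivSymbol v ξ * resolventSymbol ξ)) ∞ volume :=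
  memLp_top_of_bound ((continuous_lineDerivSymbol w).mul
    ((continuous_lineDerivSymbol v).mul continuous_resolventSymbol)).aestronglyMeasurable _
    (.of_forall (norm_lineDerivSymbol_mul_lineDerivSymbol_mul_resolventSymbol_le v w))

/-- The resolvent `(1 - Δ)⁻¹` on `L²(E; ℂ)`. -/
def freeResolvent : L2C E →L[ℂ] L2C E := fourierMul memLp_resolventSymbol

/-- The bounded operator `∂ᵥ(1 - Δ)⁻¹` on `L²(E; ℂ)`. -/
def derivFreeResolvent (v : E) : L2C E →L[ℂ] L2C E :=
  fourierMul (memLp_lineDerivSymbol_mul_resolventSymbol v)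

/-- The bounded operator `∂_w ∂ᵥ(1 - Δ)⁻¹` on `L²(E; ℂ)`. -/
def derivDerivFreeResolvent (v w : E) : L2C E →L[ℂ] L2C E :=
  fourierMul (memLp_lineDerivSymbol_mul_lineDerivSymbol_mul_resolventSymbol v w)

theorem isResolvent_freeResolvent : IsResolvent (freeResolvent : L2C E →L[ℂ] L2C E) where
  nonneg := fourierMul_nonneg _ resolventSymbol_nonneg
  le_one := fourierMul_le_one _ resolventSymbol_le_one
  injective := fourierMul_injective _ resolventSymbol_ne_zero

theorem lineDerivOp_freeResolvent (v : E) (f : L2C E) :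
    ∂_{v} (freeResolvent f : 𝓢'(E, ℂ)) = derivFreeResolvent v f :=
  lineDerivOp_fourierMul _ _ f

theorem lineDerivOp_derivFreeResolvent (v w : E) (f : L2C E) :
    ∂_{w} (derivFreeResolvent v f : 𝓢'(E, ℂ)) = derivDerivFreeResolvent v w f :=
  lineDerivOp_fourierMul _ _ f

theorem sum_derivDerivFreeResolvent {ι : Type*} [Fintype ι] (b : OrthonormalBasis ι ℝ E)
    (f : L2C E) : ∑ i, derivDerivFreeResolvent (b i) (b i) f = freeResolvent f - f := by
  refine (Lp.fourierTransformₗᵢ E ℂ).injective (Lp.ext ?_)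
  rw [map_sum, map_sub]
  have hsum : ∀ᵐ ξ, ∀ i, (𝓕 (derivDerivFreeResolvent (b i) (b i) f) : L2C E) ξ = _ :=
    ae_all_iff.2 fun i => coeFn_fourier_fourierMul _ f
  filter_upwards [Lp.coeFn_fun_finsetSum Finset.univ
      fun i => (𝓕 (derivDerivFreeResolvent (b i) (b i) f) : L2C E), hsum,
    Lp.coeFn_sub (𝓕 (freeResolvent f) : L2C E) (𝓕 f),
    coeFn_fourier_fourierMul memLp_resolventSymbol f] with ξ h hderiv hsub hJ
  refine h.trans (Eq.trans ?_ hsub.symm)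
  rw [Finset.sum_congr rfl fun i _ => hderiv i, ← Finset.sum_mul,
    sum_lineDerivSymbol_mul_self_mul_resolventSymbol, sub_mul, one_mul, Pi.sub_apply]
  exact congrArg (· - _) hJ.symm

end FreeResolvent

section WeakLaplacian

variable {n : ℕ} {i : Fin n} {f f' g g' : L2 n}

theorem HasWeakPartial.sub (hf : HasWeakPartial i f f') (hg : HasWeakPartial i g g') :
    HasWeakPartial i (f - g) (f' - g') := by
  rw [hasWeakPartial_iff_lineDerivOp_ofRealL2] at hf hg ⊢
  have hsub (a b : L2 n) : (ofRealL2 (a - b) : 𝓢'(EuclideanSpace ℝ (Fin n), ℂ)) =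
      (ofRealL2 a : 𝓢'(EuclideanSpace ℝ (Fin n), ℂ)) +
        -(ofRealL2 b : 𝓢'(EuclideanSpace ℝ (Fin n), ℂ)) := by
    rw [map_sub, ← sub_eq_add_neg]
    exact map_sub (Lp.toTemperedDistributionCLM ℂ volume 2) _ _
  rw [hsub, hsub, LineDeriv.lineDerivOp_add, LineDeriv.lineDerivOp_neg, hf, hg]

theorem HasWeakPartial.inner_eq_neg_inner (hf : HasWeakPartial i f f')
    (hg : HasWeakPartial i g g') : ⟪f', g⟫_ℝ = -⟪f, g'⟫_ℝ := by
  rw [hasWeakPartial_iff_lineDerivOp_ofRealL2, lineDerivOp_toTemperedDistribution_eq_iff] at hf hg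
  rw [← Complex.ofReal_inj, Complex.ofReal_neg, ← inner_ofRealL2, ← inner_ofRealL2,
    ← Lp.inner_fourier_eq, ← Lp.inner_fourier_eq (ofRealL2 f), L2.inner_def, L2.inner_def,
    ← integral_neg]
  refine integral_congr_ae ?_
  filter_upwards [hf, hg] with ξ hf hg
  simp only [hf, hg, lineDerivSymbol, RCLike.inner_apply, map_mul, Complex.conj_ofReal,
    Complex.conj_I, map_ofNat]
  ring

theorem MemH2.sub (hf : MemH2 f) (hg : MemH2 g) : MemH2 (f - g) := by
  intro i
  have hi := (hf i).1.sub (hg i).1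
  rw [hi.weakPartial_eq]
  refine ⟨hi, fun j => ?_⟩
  have hij := ((hf i).2 j).sub ((hg i).2 j)
  rwa [hij.weakPartial_eq]

theorem MemH2.weakPartial_sub (hf : MemH2 f) (hg : MemH2 g) (i : Fin n) :
    weakPartial i (f - g) = weakPartial i f - weakPartial i g :=
  ((hf i).1.sub (hg i).1).weakPartial_eq

theorem MemH2.weakPartial_weakPartial_sub (hf : MemH2 f) (hg : MemH2 g) (i j : Fin n) :
    weakPartial j (weakPartial i (f - g)) =
      weakPartial j (weakPartial i f) - weakPartial j (weakPartial i g) := by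
  rw [hf.weakPartial_sub hg]
  exact (((hf i).2 j).sub ((hg i).2 j)).weakPartial_eq

theorem MemH2.weakLaplacian_sub (hf : MemH2 f) (hg : MemH2 g) :
    weakLaplacian (f - g) = weakLaplacian f - weakLaplacian g := by
  simp only [weakLaplacian, hf.weakPartial_weakPartial_sub hg, Finset.sum_sub_distrib]

theorem MemH2.inner_weakLaplacian_self (hf : MemH2 f) :
    ⟪weakLaplacian f, f⟫_ℝ = -∑ i, ‖weakPartial i f‖ ^ 2 := by
  rw [weakLaplacian, sum_inner, ← Finset.sum_neg_distrib]
  refine Finset.sum_congr rfl fun i _ => ?_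
  rw [((hf i).2 i).inner_eq_neg_inner (hf i).1, real_inner_self_eq_norm_sq]

theorem ContinuousOnH2.congr {u v : ℝ → L2 n} {s : Set ℝ} (hu : ContinuousOnH2 u s)
    (h : EqOn v u s) : ContinuousOnH2 v s :=
  ⟨fun t ht => (h ht).symm ▸ hu.1 t ht, hu.2.1.congr h,
    fun i => (hu.2.2.1 i).congr fun _ ht => congrArg (weakPartial i) (h ht),
    fun i j => (hu.2.2.2 i j).congr fun _ ht =>
      congrArg (fun f => weakPartial j (weakPartial i f)) (h ht)⟩

theorem ContinuousOnH2.sub {u v : ℝ → L2 n} {s : Set ℝ} (hu : ContinuousOnH2 u s)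
    (hv : ContinuousOnH2 v s) : ContinuousOnH2 (u - v) s := by
  obtain ⟨huH2, hu0, hu1, hu2⟩ := hu
  obtain ⟨hvH2, hv0, hv1, hv2⟩ := hv
  exact ⟨fun t ht => (huH2 t ht).sub (hvH2 t ht), hu0.sub hv0,
    fun i => ((hu1 i).sub (hv1 i)).congr fun t ht => (huH2 t ht).weakPartial_sub (hvH2 t ht) i,
    fun i j => ((hu2 i j).sub (hv2 i j)).congr fun t ht =>
      (huH2 t ht).weakPartial_weakPartial_sub (hvH2 t ht) i j⟩

end WeakLaplacian

section Uniqueness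

variable {n : ℕ} {V : EuclideanSpace ℝ (Fin n) →ᵇ ℝ} {u₀ v₀ : L2 n} {u v : ℝ → L2 n} {t : ℝ}

theorem IsHeatSolution.differentiableAt (hu : IsHeatSolution V u₀ u) (ht : 0 < t) :
    DifferentiableAt ℝ u t :=
  (hu.contDiffOn_L2.differentiableOn one_ne_zero).differentiableAt (Ioi_mem_nhds ht)

theorem IsHeatSolution.sub (hu : IsHeatSolution V u₀ u) (hv : IsHeatSolution V v₀ v) :
    IsHeatSolution V (u₀ - v₀) (u - v) where
  continuousOn_L2 := hu.continuousOn_L2.sub hv.continuousOn_L2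
  contDiffOn_L2 := hu.contDiffOn_L2.sub hv.contDiffOn_L2
  continuousOn_H2 := hu.continuousOn_H2.sub hv.continuousOn_H2
  equation t ht := by
    rw [deriv_sub (hu.differentiableAt ht) (hv.differentiableAt ht), Pi.sub_apply,
      (hu.continuousOn_H2.1 t ht).weakLaplacian_sub (hv.continuousOn_H2.1 t ht)]
    filter_upwards [hu.equation t ht, hv.equation t ht, Lp.coeFn_sub (deriv u t) (deriv v t),
      Lp.coeFn_sub (weakLaplacian (u t)) (weakLaplacian (v t)), Lp.coeFn_sub (u t) (v t)]
      with x hu hv h' hΔ h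
    rw [h', hΔ, h, Pi.sub_apply, Pi.sub_apply, Pi.sub_apply]
    linear_combination hu - hv
  initial := by rw [Pi.sub_apply, hu.initial, hv.initial]

theorem IsHeatSolution.inner_deriv_nonpos (hV : 0 ≤ V) (hu : IsHeatSolution V u₀ u)
    (ht : 0 < t) : ⟪deriv u t, u t⟫_ℝ ≤ 0 := by
  have hpotential : ⟪deriv u t - weakLaplacian (u t), u t⟫_ℝ ≤ 0 := by
    rw [L2.inner_def]
    refine integral_nonpos_of_ae ?_
    filter_upwards [hu.equation t ht, Lp.coeFn_sub (deriv u t) (weakLaplacian (u t))]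
      with x hx hsub
    have hsub' : (deriv u t - weakLaplacian (u t) : L2 n) x = -(V x * u t x) := by
      rw [hsub, Pi.sub_apply]
      linear_combination hx
    rw [hsub', inner_neg_left, ← smul_eq_mul, real_inner_smul_left, Pi.zero_apply, neg_nonpos]
    exact mul_nonneg (hV x) real_inner_self_nonneg
  have hdiffusion : ⟪weakLaplacian (u t), u t⟫_ℝ ≤ 0 := by
    rw [(hu.continuousOn_H2.1 t ht).inner_weakLaplacian_self, neg_nonpos]
    positivity
  rw [inner_sub_left] at hpotential
  linarith

theorem IsHeatSolution.antitoneOn_norm_sq (hV : 0 ≤ V) (hu : IsHeatSolution V u₀ u) :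
    AntitoneOn (fun t => ‖u t‖ ^ 2) (Ici 0) := by
  refine antitoneOn_of_hasDerivWithinAt_nonpos (f' := fun t => 2 * ⟪u t, deriv u t⟫_ℝ)
    (convex_Ici 0) (hu.continuousOn_L2.norm.pow 2) (fun t ht => ?_) fun t ht => ?_
  all_goals rw [interior_Ici] at ht
  · exact (hu.differentiableAt ht).hasDerivAt.norm_sq.hasDerivWithinAt
  · rw [real_inner_comm]
    exact mul_nonpos_of_nonneg_of_nonpos zero_le_two (hu.inner_deriv_nonpos hV ht)

theorem IsHeatSolution.eqOn (hV : 0 ≤ V) (hu : IsHeatSolution V u₀ u)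
    (hv : IsHeatSolution V u₀ v) : EqOn u v (Ici 0) := by
  intro t ht
  have hle : ‖(u - v) t‖ ^ 2 ≤ ‖(u - v) 0‖ ^ 2 :=
    (hu.sub hv).antitoneOn_norm_sq hV self_mem_Ici ht ht
  rw [(hu.sub hv).initial, sub_self, norm_zero, sq_le_sq₀ (norm_nonneg _) le_rfl,
    norm_le_zero_iff] at hle
  exact sub_eq_zero.1 hle

end Uniqueness

section FreeResolventSobolev

variable {n : ℕ}

theorem hasWeakPartial_reL2_freeResolvent (i : Fin n) (f : L2C (EuclideanSpace ℝ (Fin n))) :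
    HasWeakPartial i (reL2 (freeResolvent f))
      (reL2 (derivFreeResolvent (EuclideanSpace.single i 1) f)) :=
  hasWeakPartial_reL2 (lineDerivOp_freeResolvent _ f)

theorem hasWeakPartial_reL2_derivFreeResolvent (i j : Fin n)
    (f : L2C (EuclideanSpace ℝ (Fin n))) :
    HasWeakPartial j (reL2 (derivFreeResolvent (EuclideanSpace.single i 1) f))
      (reL2 (derivDerivFreeResolvent (EuclideanSpace.single i 1) (EuclideanSpace.single j 1) f)) :=
  hasWeakPartial_reL2 (lineDerivOp_derivFreeResolvent _ _ f)

theorem weakPartial_weakPartial_reL2_freeResolvent (i j : Fin n)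
    (f : L2C (EuclideanSpace ℝ (Fin n))) :
    weakPartial j (weakPartial i (reL2 (freeResolvent f))) =
      reL2 (derivDerivFreeResolvent (EuclideanSpace.single i 1) (EuclideanSpace.single j 1) f) := by
  rw [(hasWeakPartial_reL2_freeResolvent i f).weakPartial_eq]
  exact (hasWeakPartial_reL2_derivFreeResolvent i j f).weakPartial_eq

theorem memH2_reL2_freeResolvent (f : L2C (EuclideanSpace ℝ (Fin n))) :
    MemH2 (reL2 (freeResolvent f)) := by
  intro i
  have hi := hasWeakPartial_reL2_freeResolvent i f
  rw [hi.weakPartial_eq]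
  refine ⟨hi, fun j => ?_⟩
  have hij := hasWeakPartial_reL2_derivFreeResolvent i j f
  rwa [hij.weakPartial_eq]

theorem weakLaplacian_reL2_freeResolvent (f : L2C (EuclideanSpace ℝ (Fin n))) :
    weakLaplacian (reL2 (freeResolvent f)) = reL2 (freeResolvent f - f) := by
  rw [← sum_derivDerivFreeResolvent (EuclideanSpace.basisFun (Fin n) ℝ) f, map_sum, weakLaplacian]
  simp only [EuclideanSpace.basisFun_apply, weakPartial_weakPartial_reL2_freeResolvent]

theorem continuousOnH2_reL2_freeResolvent {q : ℝ → L2C (EuclideanSpace ℝ (Fin n))} {s : Set ℝ}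
    (hq : ContinuousOn q s) : ContinuousOnH2 (fun t => reL2 (freeResolvent (q t))) s := by
  have hcont (T : L2C (EuclideanSpace ℝ (Fin n)) →L[ℂ] L2C (EuclideanSpace ℝ (Fin n))) :
      ContinuousOn (fun t => reL2 (T (q t))) s :=
    reL2.continuous.comp_continuousOn (T.continuous.comp_continuousOn hq)
  refine ⟨fun t _ => memH2_reL2_freeResolvent (q t), hcont _, fun i => ?_, fun i j => ?_⟩
  · simpa only [(hasWeakPartial_reL2_freeResolvent i _).weakPartial_eq] using hcont _
  · simpa only [weakPartial_weakPartial_reL2_freeResolvent] using hcont _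

end FreeResolventSobolev

section Potential

variable {n : ℕ} (V : EuclideanSpace ℝ (Fin n) →ᵇ ℝ)

theorem memLp_top_ofReal_boundedContinuous :
    MemLp (fun x => (V x : ℂ)) ∞ (volume : Measure (EuclideanSpace ℝ (Fin n))) :=
  memLp_top_of_bound (by fun_prop) ‖V‖ <| .of_forall fun x => by
    rw [Complex.norm_real]
    exact V.norm_coe_le_norm x

theorem memLp_top_ofReal_sqrt_boundedContinuous :
    MemLp (fun x => (√(V x) : ℂ)) ∞ (volume : Measure (EuclideanSpace ℝ (Fin n))) :=
  memLp_top_of_bound (by fun_prop) √‖V‖ <| .of_forall fun x => by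
    rw [Complex.norm_real, Real.norm_of_nonneg (Real.sqrt_nonneg _)]
    exact Real.sqrt_le_sqrt ((le_abs_self _).trans (V.norm_coe_le_norm x))

/-- Multiplication by the potential `V` on `L²(ℝⁿ; ℂ)`. -/
def potentialOp : L2C (EuclideanSpace ℝ (Fin n)) →L[ℂ] L2C (EuclideanSpace ℝ (Fin n)) :=
  mulOp (memLp_top_ofReal_boundedContinuous V)

/-- Multiplication by `√V` on `L²(ℝⁿ; ℂ)`. -/
def sqrtPotentialOp : L2C (EuclideanSpace ℝ (Fin n)) →L[ℂ] L2C (EuclideanSpace ℝ (Fin n)) :=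
  mulOp (memLp_top_ofReal_sqrt_boundedContinuous V)

variable {V}

theorem potentialOp_nonneg (hV : 0 ≤ V) : 0 ≤ potentialOp V :=
  mulOp_nonneg _ fun x => Complex.zero_le_real.2 (hV x)

theorem isSelfAdjoint_sqrtPotentialOp : IsSelfAdjoint (sqrtPotentialOp V) :=
  .of_nonneg <| mulOp_nonneg _ fun _ => Complex.zero_le_real.2 (Real.sqrt_nonneg _)

theorem sqrtPotentialOp_mul_self (hV : 0 ≤ V) :
    sqrtPotentialOp V * sqrtPotentialOp V = potentialOp V := by
  have hsq : (fun x => (√(V x) : ℂ) * (√(V x) : ℂ)) = fun x => (V x : ℂ) := funext fun x => by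
    rw [← Complex.ofReal_mul, Real.mul_self_sqrt (show 0 ≤ V x from hV x)]
  rw [sqrtPotentialOp, mulOp_mul_mulOp _ _ (hsq ▸ memLp_top_ofReal_boundedContinuous V)]
  simp only [hsq, potentialOp]

theorem coeFn_reL2_potentialOp (f : L2C (EuclideanSpace ℝ (Fin n))) :
    reL2 (potentialOp V f) =ᵐ[volume] fun x => V x * reL2 f x := by
  filter_upwards [coeFn_reL2 (potentialOp V f),
    coeFn_mulOp (memLp_top_ofReal_boundedContinuous V) f, coeFn_reL2 f] with x hre hmul hf
  rw [hre, potentialOp, hmul, Complex.re_ofReal_mul, hf]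

theorem exists_sqrtPotentialOp_eq_ofRealL2 (hV : ∀ x, 0 < V x) {u : L2 n}
    (hu : Integrable fun x => u x ^ 2 / V x) :
    ∃ f, sqrtPotentialOp V f = ofRealL2 u ∧ ‖f‖ ^ 2 = ∫ x, u x ^ 2 / V x := by
  have hsq (x : EuclideanSpace ℝ (Fin n)) : (u x / √(V x)) ^ 2 = u x ^ 2 / V x := by
    rw [div_pow, Real.sq_sqrt (hV x).le]
  have hmeas : AEStronglyMeasurable (fun x => u x / √(V x)) :=
    (Lp.aestronglyMeasurable u).div₀ (by fun_prop)
  have hmem : MemLp (fun x => u x / √(V x)) 2 := by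
    rw [memLp_two_iff_integrable_sq hmeas]
    simpa only [hsq] using hu
  refine ⟨ofRealL2 hmem.toLp, Lp.ext ?_, ?_⟩
  · filter_upwards [coeFn_mulOp (memLp_top_ofReal_sqrt_boundedContinuous V) (ofRealL2 hmem.toLp),
      coeFn_ofRealL2 hmem.toLp, coeFn_ofRealL2 u, hmem.coeFn_toLp] with x hmul hf hu hdiv
    rw [sqrtPotentialOp, hmul, hf, hu, hdiv, ← Complex.ofReal_mul,
      mul_div_cancel₀ _ (Real.sqrt_pos.2 (hV x)).ne']
  · rw [norm_ofRealL2, ← real_inner_self_eq_norm_sq, L2.inner_def]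
    refine integral_congr_ae ?_
    filter_upwards [hmem.coeFn_toLp] with x hx
    rw [hx, real_inner_self_eq_norm_sq, Real.norm_eq_abs, sq_abs, hsq]

end Potential

section Existence

variable {n : ℕ} {V : EuclideanSpace ℝ (Fin n) →ᵇ ℝ}
  {J : L2C (EuclideanSpace ℝ (Fin n)) →L[ℂ] L2C (EuclideanSpace ℝ (Fin n))} {u₀ : L2 n} {t : ℝ}

/-- `e^{-tA} u₀`, where `J = (1 + A)⁻¹`; the real part only brings it back to the real `L²(ℝⁿ)`. -/
def heatSolution (J : L2C (EuclideanSpace ℝ (Fin n)) →L[ℂ] L2C (EuclideanSpace ℝ (Fin n)))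
    (u₀ : L2 n) (t : ℝ) : L2 n :=
  reL2 (semigroup J t (ofRealL2 u₀))

theorem hasDerivAt_heatSolution (hJ : IsResolvent J) (u₀ : L2 n) (ht : 0 < t) :
    HasDerivAt (heatSolution J u₀)
      (reL2 (semigroup J t (ofRealL2 u₀) - smoothing J t (ofRealL2 u₀))) t :=
  reL2.hasFDerivAt.comp_hasDerivAt t (hJ.hasDerivAt_semigroup_apply (ofRealL2 u₀) ht)

theorem contDiffOn_heatSolution (hJ : IsResolvent J) (u₀ : L2 n) :
    ContDiffOn ℝ 1 (heatSolution J u₀) (Ioi 0) := by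
  have hsemigroup := (hJ.continuousOn_semigroup_apply (ofRealL2 u₀)).mono Ioi_subset_Ici_self
  have hsmoothing := hJ.continuousOn_smoothing.clm_apply (continuousOn_const (c := ofRealL2 u₀))
  rw [show (1 : WithTop ℕ∞) = 0 + 1 from rfl, contDiffOn_succ_iff_deriv_of_isOpen isOpen_Ioi]
  refine ⟨fun t ht => (hasDerivAt_heatSolution hJ u₀ ht).differentiableAt.differentiableWithinAt,
    by simp, contDiffOn_zero.2 ?_⟩
  exact (reL2.continuous.comp_continuousOn (hsemigroup.sub hsmoothing)).congr fun t ht =>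
    (hasDerivAt_heatSolution hJ u₀ ht).deriv

theorem semigroup_apply_eq_freeResolvent (hJV : J = freeResolvent * (1 - potentialOp V * J))
    (ht : 0 < t) (f : L2C (EuclideanSpace ℝ (Fin n))) :
    semigroup J t f = freeResolvent (smoothing J t f - potentialOp V (semigroup J t f)) := by
  rw [semigroup_of_pos J ht, mul_apply_eq_comp]
  exact congr($hJV (smoothing J t f))

theorem continuousOnH2_heatSolution (hJ : IsResolvent J)
    (hJV : J = freeResolvent * (1 - potentialOp V * J)) (u₀ : L2 n) :
    ContinuousOnH2 (heatSolution J u₀) (Ioi 0) := by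
  have hsemigroup := (hJ.continuousOn_semigroup_apply (ofRealL2 u₀)).mono Ioi_subset_Ici_self
  have hsmoothing := hJ.continuousOn_smoothing.clm_apply (continuousOn_const (c := ofRealL2 u₀))
  refine (continuousOnH2_reL2_freeResolvent <|
    hsmoothing.sub ((potentialOp V).continuous.comp_continuousOn hsemigroup)).congr ?_
  exact fun t ht => congrArg reL2 (semigroup_apply_eq_freeResolvent hJV ht (ofRealL2 u₀))

theorem weakLaplacian_heatSolution (hJV : J = freeResolvent * (1 - potentialOp V * J))
    (u₀ : L2 n) (ht : 0 < t) :
    weakLaplacian (heatSolution J u₀ t) =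
      reL2 (semigroup J t (ofRealL2 u₀) - smoothing J t (ofRealL2 u₀) +
        potentialOp V (semigroup J t (ofRealL2 u₀))) := by
  have hS := semigroup_apply_eq_freeResolvent hJV ht (ofRealL2 u₀)
  conv_lhs => rw [heatSolution, hS]
  rw [weakLaplacian_reL2_freeResolvent, ← hS, sub_add]

theorem isHeatSolution_heatSolution (hJ : IsResolvent J)
    (hJV : J = freeResolvent * (1 - potentialOp V * J)) (u₀ : L2 n) :
    IsHeatSolution V u₀ (heatSolution J u₀) where
  continuousOn_L2 := reL2.continuous.comp_continuousOn (hJ.continuousOn_semigroup_apply _)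
  contDiffOn_L2 := contDiffOn_heatSolution hJ u₀
  continuousOn_H2 := continuousOnH2_heatSolution hJ hJV u₀
  equation t ht := by
    have hequation : deriv (heatSolution J u₀) t - weakLaplacian (heatSolution J u₀ t) =
        -reL2 (potentialOp V (semigroup J t (ofRealL2 u₀))) := by
      rw [(hasDerivAt_heatSolution hJ u₀ ht).deriv, weakLaplacian_heatSolution hJV u₀ ht, map_add,
        sub_add_cancel_left]
    filter_upwards [Lp.coeFn_sub (deriv (heatSolution J u₀) t)
      (weakLaplacian (heatSolution J u₀ t)),
      Lp.coeFn_neg (reL2 (potentialOp V (semigroup J t (ofRealL2 u₀)))),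
      coeFn_reL2_potentialOp (V := V) (semigroup J t (ofRealL2 u₀))] with x hsub hneg hpotential
    rw [← Pi.sub_apply, ← hsub, hequation, hneg, Pi.neg_apply, hpotential]
    exact neg_add_cancel _
  initial := by rw [heatSolution, semigroup_zero, one_apply_eq_self, reL2_ofRealL2]

theorem norm_heatSolution_le (hJ : IsResolvent J) (u₀ : L2 n) (t : ℝ) :
    ‖heatSolution J u₀ t‖ ≤ ‖u₀‖ :=
  calc ‖heatSolution J u₀ t‖ ≤ ‖semigroup J t (ofRealL2 u₀)‖ := norm_reL2_le _
    _ ≤ 1 * ‖ofRealL2 u₀‖ := (semigroup J t).le_of_opNorm_le (hJ.norm_semigroup_le_one t) _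
    _ = ‖u₀‖ := by rw [one_mul, norm_ofRealL2]

theorem mul_sq_norm_heatSolution_le (hJ : IsResolvent J)
    (hJV : J = freeResolvent * (1 - potentialOp V * J)) (hV : ∀ x, 0 < V x)
    (hu₀ : Integrable fun x => u₀ x ^ 2 / V x) (ht : 0 ≤ t) :
    t * ‖heatSolution J u₀ t‖ ^ 2 ≤ ∫ x, u₀ x ^ 2 / V x := by
  obtain ⟨f, hf, hfnorm⟩ := exists_sqrtPotentialOp_eq_ofRealL2 hV hu₀
  have hJVJ := hJ.mul_mul_le isResolvent_freeResolvent hJV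
  rw [← sqrtPotentialOp_mul_self fun x => (hV x).le] at hJVJ
  calc t * ‖heatSolution J u₀ t‖ ^ 2 ≤ t * ‖semigroup J t (sqrtPotentialOp V f)‖ ^ 2 := by
        rw [hf]; gcongr; exact norm_reL2_le _
    _ ≤ ‖f‖ ^ 2 := hJ.mul_sq_norm_semigroup_apply_le isSelfAdjoint_sqrtPotentialOp hJVJ ht f
    _ = ∫ x, u₀ x ^ 2 / V x := hfnorm

end Existence

end

theorem theorem1p5 :
    ∃ C : ℝ, 0 < C ∧
      ∀ (n : ℕ), 1 ≤ n →
      ∀ (V : EuclideanSpace ℝ (Fin n) →ᵇ ℝ), (∀ x, 0 < V x) →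
      ∀ (u₀ : L2 n), Integrable (fun x => (u₀ x) ^ 2 / V x) volume →
        ∃ u : ℝ → L2 n, IsHeatSolution V u₀ u ∧
          (∀ w : ℝ → L2 n, IsHeatSolution V u₀ w → EqOn w u (Ici 0)) ∧
          ∀ t : ℝ, 0 ≤ t →
            (1 + t) * ‖u t‖ ^ 2 ≤ C * (‖u₀‖ ^ 2 + ∫ x, (u₀ x) ^ 2 / V x) := by
  refine ⟨1, one_pos, fun n _ V hV u₀ hu₀ => ?_⟩
  have hV' : 0 ≤ V := fun x => (hV x).le
  obtain ⟨J, hJ, hJV⟩ :=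
    isResolvent_freeResolvent.exists_perturbation (potentialOp_nonneg hV')
  have hsol := isHeatSolution_heatSolution hJ hJV u₀
  refine ⟨heatSolution J u₀, hsol, fun w hw => hw.eqOn hV' hsol, fun t ht => ?_⟩
  rw [one_mul, one_add_mul]
  exact add_le_add (pow_le_pow_left₀ (norm_nonneg _) (norm_heatSolution_le hJ u₀ t) 2)
    (mul_sq_norm_heatSolution_le hJ hJV hV hu₀ ht)
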